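/- Let $q\ge 0$ be an integer and let $\Lambda$ be a unital commutative ring. Assume that $q=0$ or that $\Lambda$ is $q$-torsion-free (that is, $q\lambda=0$ implies $\lambda=0$ for $\lambda\in\Lambda$). All Lie algebras are over $\Lambda$. For a Lie algebra $\mathfrak m$ with center $Z(\mathfrak m)$, let $Z_q(\mathfrak m)=\{x\in Z(\mathfrak m)\mid qx=0\}$ be its $q$-center. A Lie algebra $\mathfrak g$ is called $q$-capable if $\mathfrak g\cong\mathfrak m/Z_q(\mathfrak m)$ for some Lie algebra $\mathfrak m$. For a Lie algebra $\mathfrak g$, the non-abelian $q$-exterior square $\mathfrak g\wedge^q\mathfrak g$ is the Lie algebra generated by symbols $h\wedge x$ ($h,x\in\mathfrak g$) and, if $q\ge1$, also symbols $\{h\}$ ($h\in\mathfrak g$), subject to the following relations for all $h,h',x,x'\in\mathfrak g$ and $\lambda,\lambda'\in\Lambda$: $$\lambda(h\wedge x)=\lambda h\wedge x=h\wedge\lambda x,\quad (h+h')\wedge x=h\wedge x+h'\wedge x,\quad h\wedge(x+x')=h\wedge x+h\wedge x',$$ $$[h,h']\wedge x=h\wedge[h',x]-h'\wedge[h,x],\quad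 h\wedge[x,x']=[x',h]\wedge x-[x,h]\wedge x',$$ $$[h\wedge x,h'\wedge x']=[h,x]\wedge[h',x'],\quad h\wedge h=0,$$ and, if $q\ge1$, $$[\{h'\},h\wedge x]=[qh',h]\wedge x+h\wedge[qh',x],\quad \{\lambda h+\lambda'h'\}=\lambda\{h\}+\lambda'\{h'\},$$ $$[\{h\},\{h'\}]=qh\wedge qh',\quad \{[h,x]\}=q(h\wedge x).$$ The $q$-exterior center $Z^\wedge_q(\mathfrak g)$ is the set of all $z\in\mathfrak g$ such that $z\wedge x=0$ in $\mathfrak g\wedge^q\mathfrak g$ for all $x\in\mathfrak g$ and, if $q\ge1$, also $\{z\}=0$ in $\mathfrak g\wedge^q\mathfrak g$. **Theorem.** A Lie algebra $\mathfrak g$ is $q$-capable if and only if $Z^\wedge_q(\mathfrak g)=0$. -/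

import Mathlib

universe u v w

namespace QLie

/-- The `q`-center `Z_q(m) = {x ∈ Z(m) | q x = 0}` of a Lie algebra `m`, as an ideal of `m`. -/
def qCenter (Λ : Type u) [CommRing Λ] (q : ℕ) (m : Type v) [LieRing m] [LieAlgebra Λ m] :
    LieIdeal Λ m where
  carrier := {x | x ∈ LieAlgebra.center Λ m ∧ q • x = 0}
  zero_mem' := ⟨zero_mem _, smul_zero _⟩
  add_mem' := fun ha hb => ⟨add_mem ha.1 hb.1, by rw [smul_add, ha.2, hb.2, add_zero]⟩
  smul_mem' := fun c x hx => ⟨Submodule.smul_mem _ c hx.1, by rw [smul_comm, hx.2, smul_zero]⟩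
  lie_mem := fun {x m} hm => ⟨LieSubmodule.lie_mem _ hm.1, by rw [← lie_nsmul, hm.2, lie_zero]⟩

/-- A Lie algebra `g` over `Λ` is `q`-capable if `g ≅ m / Z_q(m)` for some Lie algebra `m` over `Λ`.
The universe of `m` is arbitrary, subject to containing those of `Λ` and `g`. -/
def IsQCapable (Λ : Type u) [CommRing Λ] (q : ℕ) (g : Type v) [LieRing g] [LieAlgebra Λ g] :
    Prop :=
  ∃ (m : Type (max u v w)) (_ : LieRing m) (_ : LieAlgebra Λ m),
    Nonempty (g ≃ₗ⁅Λ⁆ (m ⧸ qCenter Λ q m))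

/-- The generating symbols of the `q`-exterior square of `g`: a symbol `h ∧ x` for all `h, x ∈ g`
and, only if `q ≥ 1`, a symbol `{h}` for all `h ∈ g`. -/
inductive ExtGen (q : ℕ) (g : Type v) : Type v
  | wedge (h x : g) : ExtGen q g
  | curly (hq : 1 ≤ q) (h : g) : ExtGen q g

section
variable (Λ : Type u) [CommRing Λ] (q : ℕ) {g : Type v}

/-- The symbol `h ∧ x` in the free Lie algebra on the generating symbols. -/
noncomputable def preWedge (h x : g) : FreeLieAlgebra Λ (ExtGen q g) :=
  FreeLieAlgebra.of Λ (ExtGen.wedge h x)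

/-- The symbol `{h}` in the free Lie algebra on the generating symbols. -/
noncomputable def preCurly (hq : 1 ≤ q) (h : g) : FreeLieAlgebra Λ (ExtGen q g) :=
  FreeLieAlgebra.of Λ (ExtGen.curly hq h)

end

/-- The defining relations of the `q`-exterior square of `g` (those of the non-abelian
`q`-tensor square, together with `h ∧ h = 0`). The relations that involve the symbols `{h}` are
there only if `q ≥ 1`. -/
inductive ExtRel (Λ : Type u) [CommRing Λ] (q : ℕ) (g : Type v) [LieRing g] [LieAlgebra Λ g] :
    FreeLieAlgebra Λ (ExtGen q g) → FreeLieAlgebra Λ (ExtGen q g) → Prop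
  | smul_left (c : Λ) (h x : g) :
      ExtRel Λ q g (c • preWedge Λ q h x) (preWedge Λ q (c • h) x)
  | smul_right (c : Λ) (h x : g) :
      ExtRel Λ q g (c • preWedge Λ q h x) (preWedge Λ q h (c • x))
  | add_left (h h' x : g) :
      ExtRel Λ q g (preWedge Λ q (h + h') x) (preWedge Λ q h x + preWedge Λ q h' x)
  | add_right (h x x' : g) :
      ExtRel Λ q g (preWedge Λ q h (x + x')) (preWedge Λ q h x + preWedge Λ q h x')
  | lie_left (h h' x : g) :
      ExtRel Λ q g (preWedge Λ q ⁅h, h'⁆ x) (preWedge Λ q h ⁅h', x⁆ - preWedge Λ q h' ⁅h, x⁆)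
  | lie_right (h x x' : g) :
      ExtRel Λ q g (preWedge Λ q h ⁅x, x'⁆) (preWedge Λ q ⁅x', h⁆ x - preWedge Λ q ⁅x, h⁆ x')
  | lie_wedge_wedge (h x h' x' : g) :
      ExtRel Λ q g ⁅preWedge Λ q h x, preWedge Λ q h' x'⁆ (preWedge Λ q ⁅h, x⁆ ⁅h', x'⁆)
  | lie_curly_wedge (hq : 1 ≤ q) (h' h x : g) :
      ExtRel Λ q g ⁅preCurly Λ q hq h', preWedge Λ q h x⁆
        (preWedge Λ q ⁅q • h', h⁆ x + preWedge Λ q h ⁅q • h', x⁆)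
  | curly_linear (hq : 1 ≤ q) (c c' : Λ) (h h' : g) :
      ExtRel Λ q g (preCurly Λ q hq (c • h + c' • h'))
        (c • preCurly Λ q hq h + c' • preCurly Λ q hq h')
  | lie_curly_curly (hq : 1 ≤ q) (h h' : g) :
      ExtRel Λ q g ⁅preCurly Λ q hq h, preCurly Λ q hq h'⁆ (preWedge Λ q (q • h) (q • h'))
  | curly_lie (hq : 1 ≤ q) (h x : g) :
      ExtRel Λ q g (preCurly Λ q hq ⁅h, x⁆) (q • preWedge Λ q h x)
  | wedge_self (h : g) :
      ExtRel Λ q g (preWedge Λ q h h) 0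

/-- The ideal generated by the defining relations. -/
noncomputable def extIdeal (Λ : Type u) [CommRing Λ] (q : ℕ) (g : Type v) [LieRing g] [LieAlgebra Λ g] :
    LieIdeal Λ (FreeLieAlgebra Λ (ExtGen q g)) :=
  LieSubmodule.lieSpan Λ (FreeLieAlgebra Λ (ExtGen q g)) {z | ∃ a b, ExtRel Λ q g a b ∧ z = a - b}

/-- The non-abelian `q`-exterior square `g ∧^q g`: the Lie algebra over `Λ` presented by the
generating symbols and the defining relations above. -/
noncomputable abbrev ExtSquare (Λ : Type u) [CommRing Λ] (q : ℕ) (g : Type v) [LieRing g] [LieAlgebra Λ g] :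
    Type (max u v) :=
  FreeLieAlgebra Λ (ExtGen q g) ⧸ extIdeal Λ q g

section
variable (Λ : Type u) [CommRing Λ] (q : ℕ) {g : Type v} [LieRing g] [LieAlgebra Λ g]

/-- The element `h ∧ x` of `g ∧^q g`. -/
noncomputable def wedge (h x : g) : ExtSquare Λ q g :=
  LieSubmodule.Quotient.mk (N := extIdeal Λ q g) (preWedge Λ q h x)

/-- The element `{h}` of `g ∧^q g`, for `q ≥ 1`. -/
noncomputable def curly (hq : 1 ≤ q) (h : g) : ExtSquare Λ q g :=
  LieSubmodule.Quotient.mk (N := extIdeal Λ q g) (preCurly Λ q hq h)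

end

/-- The `q`-exterior center of `g`: the set of `z ∈ g` with `{z} = 0` and `z ∧ x = 0` in
`g ∧^q g` for all `x ∈ g`. For `q = 0` there are no symbols `{z}`, and the first condition is
void. -/
def qExteriorCenter (Λ : Type u) [CommRing Λ] (q : ℕ) (g : Type v) [LieRing g] [LieAlgebra Λ g] :
    Set g :=
  {z | (∀ hq : 1 ≤ q, curly Λ q hq z = 0) ∧ ∀ x : g, wedge Λ q z x = 0}

end QLie

namespace QLie

/-! ### Homomorphisms out of the exterior square from extensions by a `q`-center. -/

section Lift

variable {Λ : Type u} [CommRing Λ] {q : ℕ} {L : Type w} [LieRing L] [LieAlgebra Λ L]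

/-! If `g ≅ m / Z_q(m)`, then `⁅s h, s x⁆` and `q • s h` do not depend on the choice of the lift
`s`, so they define a map from `g ∧^q g` to `m` (`preHom_eq_of_extRel`). It sends `z ∧ x` and `{z}`
to `⁅s z, s x⁆` and `q • s z`; if all these symbols vanish, `s z` is in `Z_q(m)` and `z = 0`.

Conversely, let `F` be free on `g` with `p : F → g`, and let `M` be `F × (g ∧^q g)` modulo all `(q
f, -{p f})`, with the bracket `ι (π x ∧ π y)`. Then `q x = ι {π x}`, by `curlyₗ_boundary`. As `ι` is
injective, `Z_q(M)` is the preimage of the exterior center under `π`; if that center is zero, `M /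
Z_q(M) ≅ g`. -/

theorem mem_qCenter {x : L} :
    x ∈ qCenter Λ q L ↔ (∀ y : L, ⁅x, y⁆ = 0) ∧ q • x = 0 := by
  have h : x ∈ qCenter Λ q L ↔ x ∈ LieAlgebra.center Λ L ∧ q • x = 0 := Iff.rfl
  rw [h, LieModule.mem_maxTrivSubmodule]
  refine and_congr_left fun _ => forall_congr' fun y => ?_
  rw [← lie_skew, neg_eq_zero]

theorem lie_eq_of_mk_eq {x x' : L}
    (h : (LieSubmodule.Quotient.mk x : L ⧸ qCenter Λ q L) = LieSubmodule.Quotient.mk x') (y : L) :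
    ⁅x, y⁆ = ⁅x', y⁆ := by
  rw [Submodule.Quotient.eq] at h
  rw [← sub_eq_zero, ← sub_lie]
  exact (mem_qCenter.1 h).1 y

theorem lie_eq_of_mk_eq_right {x x' : L}
    (h : (LieSubmodule.Quotient.mk x : L ⧸ qCenter Λ q L) = LieSubmodule.Quotient.mk x') (y : L) :
    ⁅y, x⁆ = ⁅y, x'⁆ := by
  rw [← lie_skew, lie_eq_of_mk_eq h, lie_skew]

theorem nsmul_eq_of_mk_eq {x x' : L}
    (h : (LieSubmodule.Quotient.mk x : L ⧸ qCenter Λ q L) = LieSubmodule.Quotient.mk x') :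
    q • x = q • x' := by
  rw [Submodule.Quotient.eq] at h
  rw [← sub_eq_zero, ← smul_sub]
  exact (mem_qCenter.1 h).2

variable {g : Type v}

/-- The value on symbols of the homomorphism attached to `s : g → L`. -/
def symbolValue (s : g → L) : ExtGen q g → L
  | .wedge h x => ⁅s h, s x⁆
  | .curly _ h => q • s h

variable (Λ) in
/-- The homomorphism `h ∧ x ↦ ⁅s h, s x⁆`, `{h} ↦ q s(h)` on the free Lie algebra. -/
noncomputable def preHom (s : g → L) : FreeLieAlgebra Λ (ExtGen q g) →ₗ⁅Λ⁆ L :=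
  FreeLieAlgebra.lift Λ (symbolValue s)

@[simp]
theorem preHom_preWedge (s : g → L) (h x : g) : preHom Λ s (preWedge Λ q h x) = ⁅s h, s x⁆ :=
  FreeLieAlgebra.lift_of_apply _ _

@[simp]
theorem preHom_preCurly (s : g → L) (hq : 1 ≤ q) (h : g) :
    preHom Λ s (preCurly Λ q hq h) = q • s h :=
  FreeLieAlgebra.lift_of_apply _ _

variable [LieRing g] [LieAlgebra Λ g]

/-- The section `s` is only a map of sets, but it is linear and multiplicative modulo `Z_q(L)`, an
error that brackets and multiplication by `q` both kill. -/
theorem preHom_eq_of_extRel (s : g → L) (t : g →ₗ⁅Λ⁆ L ⧸ qCenter Λ q L)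
    (hs : ∀ h, LieSubmodule.Quotient.mk (s h) = t h)
    {a b : FreeLieAlgebra Λ (ExtGen q g)} (hab : ExtRel Λ q g a b) :
    preHom Λ s a = preHom Λ s b := by
  have hadd (h x : g) : (LieSubmodule.Quotient.mk (s (h + x)) : L ⧸ qCenter Λ q L) =
      LieSubmodule.Quotient.mk (s h + s x) := by
    rw [hs, map_add, ← hs, ← hs]; rfl
  have hsmul (c : Λ) (h : g) : (LieSubmodule.Quotient.mk (s (c • h)) : L ⧸ qCenter Λ q L) =
      LieSubmodule.Quotient.mk (c • s h) := by
    rw [hs, map_smul, ← hs]; rfl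
  have hlie (h x : g) : (LieSubmodule.Quotient.mk (s ⁅h, x⁆) : L ⧸ qCenter Λ q L) =
      LieSubmodule.Quotient.mk ⁅s h, s x⁆ := by
    rw [hs, LieHom.map_lie, ← hs, ← hs]; rfl
  have hnsmul (h : g) : (LieSubmodule.Quotient.mk (s (q • h)) : L ⧸ qCenter Λ q L) =
      LieSubmodule.Quotient.mk (q • s h) := by
    simpa only [Nat.cast_smul_eq_nsmul] using hsmul (q : Λ) h
  have hcomb (c c' : Λ) (h h' : g) :
      (LieSubmodule.Quotient.mk (s (c • h + c' • h')) : L ⧸ qCenter Λ q L) =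
      LieSubmodule.Quotient.mk (c • s h + c' • s h') := by
    rw [hs, map_add, map_smul, map_smul, ← hs, ← hs]; rfl
  cases hab with
  | smul_left c h x =>
    simp only [map_smul, preHom_preWedge, lie_eq_of_mk_eq (hsmul _ _), smul_lie]
  | smul_right c h x =>
    simp only [map_smul, preHom_preWedge, lie_eq_of_mk_eq_right (hsmul _ _), lie_smul]
  | add_left h h' x =>
    simp only [map_add, preHom_preWedge, lie_eq_of_mk_eq (hadd _ _), add_lie]
  | add_right h x x' =>
    simp only [map_add, preHom_preWedge, lie_eq_of_mk_eq_right (hadd _ _), lie_add]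
  | lie_left h h' x =>
    simp only [map_sub, preHom_preWedge, lie_eq_of_mk_eq (hlie _ _),
      lie_eq_of_mk_eq_right (hlie _ _), lie_lie]
  | lie_right h x x' =>
    simp only [map_sub, preHom_preWedge, lie_eq_of_mk_eq (hlie _ _),
      lie_eq_of_mk_eq_right (hlie _ _)]
    rw [leibniz_lie, ← lie_skew (s x) ⁅s h, s x'⁆, ← lie_skew (s h) (s x'), neg_lie, neg_neg,
      ← lie_skew (s h) (s x), neg_lie]
    abel
  | lie_wedge_wedge h x h' x' =>
    simp only [LieHom.map_lie, preHom_preWedge, lie_eq_of_mk_eq (hlie _ _),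
      lie_eq_of_mk_eq_right (hlie _ _)]
  | lie_curly_wedge hq h' h x =>
    simp only [LieHom.map_lie, map_add, preHom_preWedge, preHom_preCurly,
      lie_eq_of_mk_eq (hlie _ _), lie_eq_of_mk_eq_right (hlie _ _),
      lie_eq_of_mk_eq (hnsmul _)]
    exact leibniz_lie _ _ _
  | curly_linear hq c c' h h' =>
    simp only [map_add, map_smul, preHom_preCurly, nsmul_eq_of_mk_eq (hcomb _ _ _ _), smul_add,
      smul_comm q]
  | lie_curly_curly hq h h' =>
    simp only [LieHom.map_lie, preHom_preWedge, preHom_preCurly, lie_eq_of_mk_eq (hnsmul _),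
      lie_eq_of_mk_eq_right (hnsmul _)]
  | curly_lie hq h x =>
    simp only [map_nsmul, preHom_preWedge, preHom_preCurly, nsmul_eq_of_mk_eq (hlie _ _)]
  | wedge_self h => simp

theorem extIdeal_le_ker {φ : FreeLieAlgebra Λ (ExtGen q g) →ₗ⁅Λ⁆ L}
    (hφ : ∀ a b, ExtRel Λ q g a b → φ a = φ b) : extIdeal Λ q g ≤ φ.ker := by
  refine LieSubmodule.lieSpan_le.2 ?_
  rintro _ ⟨a, b, hab, rfl⟩
  simp [hφ a b hab]

end Lift

/-! ### Structure of the exterior square and its boundary map to `g`. -/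

section Square

variable {Λ : Type u} [CommRing Λ] {q : ℕ} {g : Type v} [LieRing g] [LieAlgebra Λ g]

/-- The class of a generating symbol in `g ∧^q g`. -/
noncomputable def symbol (Λ : Type u) [CommRing Λ] (q : ℕ) (g : Type v) [LieRing g]
    [LieAlgebra Λ g] (a : ExtGen q g) : ExtSquare Λ q g :=
  LieSubmodule.Quotient.mk (N := extIdeal Λ q g) (FreeLieAlgebra.of Λ a)

theorem mk_eq_of_extRel {a b : FreeLieAlgebra Λ (ExtGen q g)} (h : ExtRel Λ q g a b) :
    (LieSubmodule.Quotient.mk a : ExtSquare Λ q g) = LieSubmodule.Quotient.mk b :=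
  (Submodule.Quotient.eq _).2 (LieSubmodule.subset_lieSpan ⟨a, b, h, rfl⟩)

variable (Λ q g) in
/-- The map `(h, x) ↦ h ∧ x` as a bilinear map. -/
noncomputable def wedgeₗ : g →ₗ[Λ] g →ₗ[Λ] ExtSquare Λ q g :=
  LinearMap.mk₂ Λ (wedge Λ q) (fun _ _ _ => mk_eq_of_extRel (.add_left _ _ _))
    (fun _ _ _ => (mk_eq_of_extRel (.smul_left _ _ _)).symm)
    (fun _ _ _ => mk_eq_of_extRel (.add_right _ _ _))
    (fun _ _ _ => (mk_eq_of_extRel (.smul_right _ _ _)).symm)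

@[simp]
theorem wedgeₗ_apply (h x : g) : wedgeₗ Λ q g h x = wedge Λ q h x := rfl

variable (Λ q g) in
/-- The map `h ↦ {h}` as a linear map; it is zero for `q = 0`. -/
noncomputable def curlyₗ : g →ₗ[Λ] ExtSquare Λ q g :=
  if hq : 1 ≤ q then
    { toFun := curly Λ q hq
      map_add' := fun h h' => by
        have := mk_eq_of_extRel (ExtRel.curly_linear (Λ := Λ) hq 1 1 h h')
        rwa [one_smul, one_smul, one_smul, one_smul] at this
      map_smul' := fun c h => by
        have := mk_eq_of_extRel (ExtRel.curly_linear (Λ := Λ) hq c 0 h 0)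
        rwa [zero_smul, zero_smul, add_zero, add_zero] at this }
  else 0

theorem curlyₗ_apply (hq : 1 ≤ q) (h : g) : curlyₗ Λ q g h = curly Λ q hq h := by
  rw [curlyₗ, dif_pos hq]; rfl

theorem curlyₗ_lie (h x : g) : curlyₗ Λ q g ⁅h, x⁆ = q • wedge Λ q h x := by
  rcases Nat.eq_zero_or_pos q with rfl | hq
  · simp [curlyₗ]
  · rw [curlyₗ_apply hq]
    exact mk_eq_of_extRel (.curly_lie hq h x)

theorem wedge_self (h : g) : wedge Λ q h h = 0 :=
  mk_eq_of_extRel (.wedge_self h)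

theorem wedge_neg_swap (h x : g) : -wedge Λ q x h = wedge Λ q h x := by
  have H := wedge_self (Λ := Λ) (q := q) (h + x)
  simp only [← wedgeₗ_apply, map_add, LinearMap.add_apply] at H
  simp only [wedgeₗ_apply, wedge_self, zero_add, add_zero] at H
  exact neg_eq_of_add_eq_zero_right H

theorem wedge_lie_left (h h' x : g) :
    wedge Λ q ⁅h, h'⁆ x = wedge Λ q h ⁅h', x⁆ - wedge Λ q h' ⁅h, x⁆ :=
  mk_eq_of_extRel (.lie_left h h' x)

theorem wedge_leibniz (y h x : g) :
    wedge Λ q y ⁅h, x⁆ = wedge Λ q ⁅y, h⁆ x + wedge Λ q h ⁅y, x⁆ := by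
  rw [wedge_lie_left, sub_add_cancel]

variable (Λ q g) in
/-- The homomorphism `g ∧^q g → g` with `h ∧ x ↦ ⁅h, x⁆` and `{h} ↦ q h`. -/
noncomputable def boundary : ExtSquare Λ q g →ₗ[Λ] g :=
  (extIdeal Λ q g).toSubmodule.liftQ (preHom (q := q) Λ (id : g → g) : _ →ₗ[Λ] g) <| by
    -- The identity of `g` lifts the projection to `g / Z_q(g)`, so the lifting argument applies
    -- with `L = g`.
    let t : g →ₗ⁅Λ⁆ g ⧸ qCenter Λ q g :=
      { (qCenter Λ q g).toSubmodule.mkQ with map_lie' := rfl }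
    exact extIdeal_le_ker fun a b => preHom_eq_of_extRel id t fun _ => rfl

theorem boundary_wedge (h x : g) : boundary Λ q g (wedge Λ q h x) = ⁅h, x⁆ :=
  preHom_preWedge (Λ := Λ) (q := q) (id : g → g) h x

theorem boundary_curlyₗ (h : g) : boundary Λ q g (curlyₗ Λ q g h) = q • h := by
  rcases Nat.eq_zero_or_pos q with rfl | hq
  · simp [curlyₗ]
  · rw [curlyₗ_apply hq]
    exact preHom_preCurly (Λ := Λ) (q := q) (id : g → g) hq h

/-- All bracket relations take this one form, which makes the linear span of the symbols closed
under brackets. -/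
theorem lie_symbol (a b : ExtGen q g) :
    ⁅symbol Λ q g a, symbol Λ q g b⁆ =
      wedge Λ q (boundary Λ q g (symbol Λ q g a)) (boundary Λ q g (symbol Λ q g b)) := by
  have hw (h x : g) : symbol Λ q g (.wedge h x) = wedge Λ q h x := rfl
  have hc (hq : 1 ≤ q) (h : g) : symbol Λ q g (.curly hq h) = curlyₗ Λ q g h := by
    rw [curlyₗ_apply hq]; rfl
  have hcw (hq : 1 ≤ q) (h' h x : g) :
      ⁅curlyₗ Λ q g h', wedge Λ q h x⁆ = wedge Λ q (q • h') ⁅h, x⁆ := by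
    rw [wedge_leibniz, curlyₗ_apply hq]
    exact mk_eq_of_extRel (.lie_curly_wedge hq h' h x)
  rcases a with ⟨h, x⟩ | ⟨hq, h⟩ <;> rcases b with ⟨h', x'⟩ | ⟨hq', h'⟩ <;>
    simp only [hw, hc, boundary_wedge, boundary_curlyₗ]
  · exact mk_eq_of_extRel (.lie_wedge_wedge h x h' x')
  · rw [← lie_skew, hcw hq', wedge_neg_swap]
  · exact hcw hq _ _ _
  · rw [curlyₗ_apply hq, curlyₗ_apply hq]
    exact mk_eq_of_extRel (.lie_curly_curly hq h h')

theorem mem_of_forall_of_mem {R : Type u} [CommRing R] {X : Type v}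
    (K : LieSubalgebra R (FreeLieAlgebra R X)) (h : ∀ x, FreeLieAlgebra.of R x ∈ K)
    (y : FreeLieAlgebra R X) : y ∈ K := by
  have H : K.incl.comp (FreeLieAlgebra.lift R fun x => (⟨_, h x⟩ : K)) = LieHom.id :=
    FreeLieAlgebra.hom_ext fun x => by simp
  have := LieHom.congr_fun H y
  rw [LieHom.id_apply] at this
  rw [← this]
  exact Subtype.property _

theorem span_range_symbol : Submodule.span Λ (Set.range (symbol Λ q g)) = ⊤ := by
  set S := Submodule.span Λ (Set.range (symbol Λ q g))
  have hS : ∀ u ∈ S, ∀ v ∈ S, ⁅u, v⁆ ∈ S := by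
    intro u hu v hv
    induction hu, hv using Submodule.span_induction₂ with
    | mem_mem u v hu hv =>
      obtain ⟨a, rfl⟩ := hu
      obtain ⟨b, rfl⟩ := hv
      rw [lie_symbol]
      exact Submodule.subset_span ⟨.wedge _ _, rfl⟩
    | zero_left => simp
    | zero_right => simp
    | add_left _ _ _ _ _ _ h h' => rw [add_lie]; exact add_mem h h'
    | add_right _ _ _ _ _ _ h h' => rw [lie_add]; exact add_mem h h'
    | smul_left c _ _ _ _ h => rw [smul_lie]; exact S.smul_mem c h
    | smul_right c _ _ _ _ h => rw [lie_smul]; exact S.smul_mem c h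
  let K : LieSubalgebra Λ (FreeLieAlgebra Λ (ExtGen q g)) :=
    { S.comap (extIdeal Λ q g).toSubmodule.mkQ with
      lie_mem' := fun hu hv => hS _ hu _ hv }
  rw [eq_top_iff]
  intro u _
  induction u using Submodule.Quotient.induction_on with
  | _ y => exact mem_of_forall_of_mem K (fun x => Submodule.subset_span ⟨x, rfl⟩) y

/-- Both sides are linear in `u`, so symbols suffice: on `h ∧ x` this is the relation for `{⁅h,
x⁆}`, on `{h}` it is linearity. -/
theorem curlyₗ_boundary (u : ExtSquare Λ q g) : curlyₗ Λ q g (boundary Λ q g u) = q • u := by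
  have hu : u ∈ Submodule.span Λ (Set.range (symbol Λ q g)) := by simp [span_range_symbol]
  induction hu using Submodule.span_induction with
  | mem u hu =>
    obtain ⟨⟨h, x⟩ | ⟨hq, h⟩, rfl⟩ := hu
    · exact (congrArg _ (boundary_wedge h x)).trans (curlyₗ_lie h x)
    · have hc : symbol Λ q g (.curly hq h) = curlyₗ Λ q g h := by rw [curlyₗ_apply hq]; rfl
      rw [hc, boundary_curlyₗ, map_nsmul]
  | zero => simp
  | add _ _ _ _ h h' => simp only [map_add, h, h', smul_add]
  | smul c _ _ h => rw [map_smul, map_smul, h, smul_comm]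

theorem mem_qExteriorCenter {z : g} :
    z ∈ qExteriorCenter Λ q g ↔ curlyₗ Λ q g z = 0 ∧ ∀ x, wedge Λ q z x = 0 := by
  refine and_congr_left fun _ => ⟨fun h => ?_, fun h hq => (curlyₗ_apply hq z).symm.trans h⟩
  by_cases hq : 1 ≤ q
  · rw [curlyₗ_apply hq, h hq]
  · simp [curlyₗ, hq]

end Square

/-! ### The extension of `g` that witnesses capability, and the equivalence. -/

section Extension

variable {Λ : Type u} [CommRing Λ] {q : ℕ} {g : Type v} [LieRing g] [LieAlgebra Λ g]
  {M : Type w} [AddCommGroup M] [Module Λ M]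

/-- The Lie ring structure `⁅x, y⁆ = ι (π x ∧ π y)` on a module `M` over `g` that receives a map
from `g ∧^q g`. -/
noncomputable abbrev wedgeLieRing (π : M →ₗ[Λ] g) (ι : ExtSquare Λ q g →ₗ[Λ] M)
    (hι : ∀ u, π (ι u) = boundary Λ q g u) : LieRing M where
  bracket x y := ι (wedgeₗ Λ q g (π x) (π y))
  add_lie x y z := by simp only [map_add, LinearMap.add_apply]
  lie_add x y z := by simp only [map_add]
  lie_self x := by rw [wedgeₗ_apply, wedge_self, map_zero]
  leibniz_lie x y z := by
    simp only [hι, wedgeₗ_apply, boundary_wedge, ← map_add, ← wedge_leibniz]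

/-- `wedgeLieRing` as a Lie algebra. -/
noncomputable abbrev wedgeLieAlgebra (π : M →ₗ[Λ] g) (ι : ExtSquare Λ q g →ₗ[Λ] M)
    (hι : ∀ u, π (ι u) = boundary Λ q g u) :
    letI := wedgeLieRing π ι hι
    LieAlgebra Λ M :=
  letI := wedgeLieRing π ι hι
  { lie_smul := fun c x y => by
      change ι (wedgeₗ Λ q g (π x) (π (c • y))) = c • ι (wedgeₗ Λ q g (π x) (π y))
      simp only [map_smul] }

theorem nonempty_equiv_of_ker_eq {L : Type w} [LieRing L] [LieAlgebra Λ L] (f : L →ₗ⁅Λ⁆ g)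
    (hf : Function.Surjective f) {I : LieIdeal Λ L} (hI : f.ker = I) :
    Nonempty (g ≃ₗ⁅Λ⁆ (L ⧸ I)) := by
  subst hI
  have hr : f.range = ⊤ := f.range_eq_top.2 hf
  exact ⟨(f.quotKerEquivRange.trans
    ((LieEquiv.ofEq _ _ (congrArg _ hr)).trans LieSubalgebra.topEquiv)).symm⟩

theorem isQCapable_of_wedge_extension {M : Type (max u v w)} [AddCommGroup M] [Module Λ M]
    (π : M →ₗ[Λ] g) (ι : ExtSquare Λ q g →ₗ[Λ] M) (hι : ∀ u, π (ι u) = boundary Λ q g u)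
    (hπ : Function.Surjective π) (hinj : Function.Injective ι)
    (hq : ∀ x, q • x = ι (curlyₗ Λ q g (π x)))
    (hz : qExteriorCenter Λ q g = {0}) : IsQCapable.{u, v, w} Λ q g := by
  let _ := wedgeLieRing π ι hι
  let _ := wedgeLieAlgebra π ι hι
  have hlie (x y : M) : ⁅x, y⁆ = ι (wedge Λ q (π x) (π y)) := rfl
  have hπlie (x y : M) : π ⁅x, y⁆ = ⁅π x, π y⁆ := by rw [hlie, hι, boundary_wedge]
  let f : M →ₗ⁅Λ⁆ g := { π with map_lie' := hπlie _ _ }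
  refine ⟨M, inferInstance, inferInstance, nonempty_equiv_of_ker_eq f hπ ?_⟩
  ext x
  have hx : x ∈ f.ker ↔ π x = 0 := LieHom.mem_ker
  have hz' : π x = 0 ↔ π x ∈ qExteriorCenter Λ q g := by rw [hz, Set.mem_singleton_iff]
  rw [hx, hz', mem_qCenter, mem_qExteriorCenter, hq, map_eq_zero_iff ι hinj, and_comm]
  refine and_congr_left fun _ => ?_
  simp only [hlie, map_eq_zero_iff ι hinj]
  exact (hπ.forall (p := fun z => wedge Λ q (π x) z = 0))

theorem isQCapable_of_qExteriorCenter_eq (hq : q = 0 ∨ ∀ a : Λ, q • a = 0 → a = 0)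
    (hz : qExteriorCenter Λ q g = {0}) : IsQCapable.{u, v, w} Λ q g := by
  let F := ULift.{w} g →₀ Λ
  let p : F →ₗ[Λ] g := Finsupp.linearCombination Λ ULift.down
  have hp : Function.Surjective p := fun x => ⟨Finsupp.single ⟨x⟩ 1, by
    rw [Finsupp.linearCombination_single, one_smul]⟩
  -- The hypothesis on `q` enters here, to make `ι` injective; freeness of `F` passes
  -- torsion-freeness from `Λ` to `F`.
  have hF (f : F) (hf : q • f = 0) : curlyₗ Λ q g (p f) = 0 := by
    rcases hq with rfl | hq
    · simp [curlyₗ]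
    · have : f = 0 := Finsupp.ext fun i => hq _ (DFunLike.congr_fun hf i)
      simp [this]
  -- Dividing by the range of `r` forces `q f = {p f}`.
  let r : F →ₗ[Λ] F × ExtSquare Λ q g :=
    LinearMap.prod ((q : Λ) • LinearMap.id) (-(curlyₗ Λ q g ∘ₗ p))
  have hr (f : F) : r f = (q • f, -curlyₗ Λ q g (p f)) := by
    simp [r, Nat.cast_smul_eq_nsmul]
  let π' : F × ExtSquare Λ q g →ₗ[Λ] g := p.coprod (boundary Λ q g)
  let π : ((F × ExtSquare Λ q g) ⧸ LinearMap.range r) →ₗ[Λ] g :=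
    (LinearMap.range r).liftQ π' <| by
      rintro _ ⟨f, rfl⟩
      simp [hr, π', boundary_curlyₗ]
  let ι : ExtSquare Λ q g →ₗ[Λ] (F × ExtSquare Λ q g) ⧸ LinearMap.range r :=
    (LinearMap.range r).mkQ ∘ₗ LinearMap.inr Λ F (ExtSquare Λ q g)
  refine isQCapable_of_wedge_extension π ι (fun u => ?_) (fun x => ?_) ?_ (fun x => ?_) hz
  · simp [π, ι, π']
  · obtain ⟨f, rfl⟩ := hp x
    exact ⟨Submodule.Quotient.mk (f, 0), by simp [π, π']⟩
  · refine (injective_iff_map_eq_zero ι).2 fun u hu => ?_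
    obtain ⟨f, hf⟩ := (Submodule.Quotient.mk_eq_zero _).1 hu
    rw [hr] at hf
    obtain ⟨h₁, h₂⟩ := Prod.ext_iff.1 hf
    exact h₂.symm.trans (by simp [hF f h₁])
  · induction x using Submodule.Quotient.induction_on with
    | _ x =>
      obtain ⟨f, u⟩ := x
      -- The second component of `q (f, u) - (0, {p f + ∂ u})` is `-{p f}`, since `{∂ u} = q u`;
      -- hence the difference is `r f`.
      refine (Submodule.Quotient.eq _).2 ⟨f, ?_⟩
      rw [hr]
      ext1
      · simp
      · simp [π, π', curlyₗ_boundary]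

theorem qExteriorCenter_eq_of_isQCapable (h : IsQCapable.{u, v, w} Λ q g) :
    qExteriorCenter Λ q g = {0} := by
  obtain ⟨m, _, _, ⟨e⟩⟩ := h
  refine Set.eq_singleton_iff_unique_mem.2
    ⟨mem_qExteriorCenter.2 ⟨map_zero _, fun x => LinearMap.map_zero₂ (wedgeₗ Λ q g) x⟩, ?_⟩
  rintro z ⟨hc, hw⟩
  have hs (y : g) : ∃ x : m, LieSubmodule.Quotient.mk x = e y :=
    Submodule.Quotient.mk_surjective _ (e y)
  choose s hs using hs
  have hker : extIdeal Λ q g ≤ (preHom Λ s).ker :=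
    extIdeal_le_ker fun a b => preHom_eq_of_extRel s (e : g →ₗ⁅Λ⁆ _) hs
  have hlie (x : g) : ⁅s z, s x⁆ = 0 := by
    rw [← preHom_preWedge (Λ := Λ) (q := q)]
    exact LieHom.mem_ker.1 (hker ((Submodule.Quotient.mk_eq_zero _).1 (hw x)))
  have hsmul : q • s z = 0 := by
    rcases Nat.eq_zero_or_pos q with h0 | hq
    · rw [h0, zero_smul]
    · rw [← preHom_preCurly (Λ := Λ) s hq z]
      exact LieHom.mem_ker.1 (hker ((Submodule.Quotient.mk_eq_zero _).1 (hc hq)))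
  have hmem : s z ∈ qCenter Λ q m := by
    refine mem_qCenter.2 ⟨fun y => ?_, hsmul⟩
    have hy : (LieSubmodule.Quotient.mk y : m ⧸ qCenter Λ q m) =
        LieSubmodule.Quotient.mk (s (e.symm (LieSubmodule.Quotient.mk y))) := by
      rw [hs, e.apply_symm_apply]
    rw [lie_eq_of_mk_eq_right hy, hlie]
  have hez : e z = 0 := (hs z).symm.trans ((Submodule.Quotient.mk_eq_zero _).2 hmem)
  exact e.injective (hez.trans (map_zero e.toLieHom).symm)

end Extension

end QLie

theorem theorem4p6 (Λ : Type u) [CommRing Λ] (q : ℕ)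
    (hq : q = 0 ∨ ∀ a : Λ, q • a = 0 → a = 0)
    (g : Type v) [LieRing g] [LieAlgebra Λ g] :
    QLie.IsQCapable.{u, v, w} Λ q g ↔ QLie.qExteriorCenter Λ q g = {0} :=
  ⟨QLie.qExteriorCenter_eq_of_isQCapable, QLie.isQCapable_of_qExteriorCenter_eq hq⟩
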